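/- All graphs are finite, simple and undirected. The Wiener index of a connected graph $G$ is $W(G)=\sum_{\{x,y\}\subseteq V(G)} d_G(x,y)$, the sum of the distances over all unordered pairs of vertices. A graph is nonseparable if it is connected, has at least two vertices and has no cut-vertex (that is, it is $2$-connected or is $K_2$); a block of $G$ is a maximal nonseparable subgraph of $G$. For $m\ge 3$ let $C_m$ be the cycle on $m$ vertices, put $C_2=K_2$, and let $C_{n-1}\circ C_2$ be the graph obtained from disjoint copies of $C_{n-1}$ and $C_2$ by identifying a vertex of $C_{n-1}$ with a vertex of $C_2$ (a cycle with one pendant edge; up to isomorphism the choice of the vertices is immaterial). Let $n\ge 4$. Then $C_{n-1}\circ C_2$ is a connected graph on $n$ vertices with exactly two blocks, and every connected graph $G$ on $n$ vertices with exactly two blocks satisfies $W(G)\le W(C_{n-1}\circ C_2)$. That is, among the connected graphs on $n$ vertices with exactly two blocks, the maximal Wiener index is attained by $C_{n-1}\circ C_2$. -/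

import Mathlib

namespace SimpleGraph

/-- The Wiener index: the sum of the distances over all unordered pairs of vertices
(the degenerate pairs `{v, v}` contribute `0`). -/
noncomputable def wienerIndex {V : Type*} [Fintype V] (G : SimpleGraph V) : ℕ :=
  open Classical in
  ∑ e : Sym2 V, Sym2.lift ⟨fun a b => G.dist a b, fun _ _ => G.dist_comm⟩ e

/-- `v` is a cut-vertex of `G`: deleting `v` separates two other vertices `a`, `b` that lie in the
same connected component of `G`. -/
def IsCutVertex {V : Type*} (G : SimpleGraph V) (v : V) : Prop :=
  ∃ a b : ({v}ᶜ : Set V), G.Reachable a b ∧ ¬ (G.induce ({v}ᶜ : Set V)).Reachable a b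

/-- A graph is nonseparable if it is connected, has at least two vertices and has no cut-vertex;
that is, it is 2-connected or a single edge. -/
def IsNonseparable {V : Type*} (G : SimpleGraph V) : Prop :=
  G.Connected ∧ Nontrivial V ∧ ∀ v, ¬ G.IsCutVertex v

/-- The set of blocks of `G`: the maximal nonseparable subgraphs. -/
def blocks {V : Type*} (G : SimpleGraph V) : Set G.Subgraph :=
  {B | Maximal (fun H : G.Subgraph => H.coe.IsNonseparable) B}

/-- The graph `G ∘ H` obtained from disjoint copies of `G` and `H` by identifying the vertex `u`
of `G` with the vertex `w` of `H`. The identified vertex is represented by `Sum.inl u`. -/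
def coalescence {V W : Type*} (G : SimpleGraph V) (u : V) (H : SimpleGraph W) (w : W) :
    SimpleGraph (V ⊕ {y : W // y ≠ w}) where
  Adj
    | .inl a, .inl b => G.Adj a b
    | .inr x, .inr y => H.Adj x y
    | .inl a, .inr y => a = u ∧ H.Adj w y
    | .inr x, .inl b => b = u ∧ H.Adj w x
  symm := ⟨by
    rintro (a | x) (b | y) h
    · exact G.adj_symm h
    · exact h
    · exact h
    · exact H.adj_symm h⟩
  loopless := ⟨by
    rintro (a | x) h
    · exact G.irrefl h
    · exact H.irrefl h⟩

end SimpleGraph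

/-! A connected graph with two blocks has a cut-vertex `v`, and splits at `v` into two nonseparable
induced subgraphs on `p + 1` and `q + 1` vertices, where `p + q = n - 1`
(`Connected.exists_isNonseparable_pair`).

In a nonseparable graph on `m` vertices, every positive distance level below the eccentricity of a
vertex has at least two elements, so distances from a vertex sum to at most `⌊m² / 4⌋`
(`IsNonseparable.sum_dist_le`). Distances across the two pieces are bounded through `v`. Adding up
bounds `2 * W` by a function of `p` and `q` (`Connected.two_mul_wienerIndex_le`), which is largest
when `p = 1` or `q = 1` (`Nat.wiener_two_blocks_le`).

The cycle with a pendant edge reaches that value; only the lower bound is needed, and it comes from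
1-Lipschitz functions (`le_two_mul_wienerIndex_coalescence`). -/

namespace SimpleGraph

variable {V W : Type*}

/-! ### Cut-vertices and nonseparability through closed sets. -/

lemma Reachable.mem_of_closed {G : SimpleGraph V} {a b : V} (h : G.Reachable a b) {S : Set V}
    (ha : a ∈ S) (hS : ∀ x ∈ S, ∀ y, G.Adj x y → y ∈ S) : b ∈ S := by
  rw [reachable_iff_reflTransGen] at h
  induction h with
  | refl => exact ha
  | tail _ hbc ih => exact hS _ ih _ hbc

/-- In a connected graph, a cut-vertex `w` is one for which `{w}ᶜ` contains a proper nonempty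
set that is closed under adjacency avoiding `w`. -/
lemma Connected.isCutVertex_iff {G : SimpleGraph V} (hG : G.Connected) (w : V) :
    G.IsCutVertex w ↔ ∃ S : Set V, w ∉ S ∧ (∃ p, p ∈ S) ∧ (∃ q, q ∉ S ∧ q ≠ w) ∧
      ∀ x ∈ S, ∀ y, G.Adj x y → y ≠ w → y ∈ S := by
  constructor
  · rintro ⟨a, b, -, hab⟩
    refine ⟨{x | ∃ hx : x ≠ w, (G.induce ({w}ᶜ : Set V)).Reachable a ⟨x, hx⟩}, ?_, ?_, ?_, ?_⟩
    · rintro ⟨h, -⟩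
      exact h rfl
    · exact ⟨a, a.2, Reachable.refl _⟩
    · refine ⟨b, ?_, b.2⟩
      rintro ⟨h, h'⟩
      exact hab h'
    · rintro x ⟨hx, hr⟩ y hxy hy
      exact ⟨hy, hr.trans (Adj.reachable (by simpa using hxy))⟩
  · rintro ⟨S, hw, ⟨p, hp⟩, ⟨q, hq, hqw⟩, hS⟩
    have hpw : p ≠ w := fun h => hw (h ▸ hp)
    refine ⟨⟨p, hpw⟩, ⟨q, hqw⟩, hG _ _, fun h => hq ?_⟩
    exact h.mem_of_closed (S := {x | (x : V) ∈ S}) hp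
      (fun x hx y hxy => hS x hx y (by simpa using hxy) y.2)

lemma IsNonseparable.mem_of_closed {G : SimpleGraph V} (hG : G.IsNonseparable) {S : Set V} {w : V}
    (hS : ∀ x ∈ S, ∀ y, G.Adj x y → y ≠ w → y ∈ S) {p q : V} (hp : p ∈ S) (hpw : p ≠ w)
    (hqw : q ≠ w) : q ∈ S := by
  by_contra hq
  refine hG.2.2 w ((hG.1.isCutVertex_iff w).2 ⟨S \ {w}, by simp, ⟨p, hp, hpw⟩,
    ⟨q, fun h => hq h.1, hqw⟩, fun x hx y hxy hy => ⟨hS x hx.1 y hxy hy, hy⟩⟩)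

lemma Iso.isNonseparable {G : SimpleGraph V} {H : SimpleGraph W} (e : G ≃g H)
    (hG : G.IsNonseparable) : H.IsNonseparable := by
  have hH : H.Connected := e.connected_iff.1 hG.1
  have := hG.2.1
  refine ⟨hH, e.symm.toEquiv.nontrivial, fun w hw => ?_⟩
  obtain ⟨S, hwS, ⟨p, hp⟩, ⟨q, hq, hqw⟩, hS⟩ := (hH.isCutVertex_iff w).1 hw
  refine hG.2.2 (e.symm w) ((hG.1.isCutVertex_iff _).2 ⟨e ⁻¹' S, by simpa using hwS,
    ⟨e.symm p, by simpa using hp⟩, ⟨e.symm q, by simpa using hq, by simpa using hqw⟩,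
    fun x hx y hxy hy => ?_⟩)
  refine hS _ hx _ (e.map_adj_iff.2 hxy) ?_
  rintro rfl
  simp at hy

/-- A nonseparable subgraph meeting a set `S` that is closed under adjacency avoiding `w`
lies in `S ∪ {w}`. -/
lemma Subgraph.verts_subset_insert_of_closed {G : SimpleGraph V} {B : G.Subgraph}
    (hB : B.coe.IsNonseparable) {S : Set V} {w p : V}
    (hS : ∀ x ∈ S, ∀ y, B.Adj x y → y ≠ w → y ∈ S) (hp : p ∈ S) (hpB : p ∈ B.verts) (hpw : p ≠ w) :
    B.verts ⊆ insert w S := by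
  intro q hq
  by_cases hqw : q = w
  · exact Or.inl hqw
  right
  by_cases hw : w ∈ B.verts
  · exact hB.mem_of_closed (S := {x | (x : V) ∈ S}) (w := ⟨w, hw⟩) (p := ⟨p, hpB⟩) (q := ⟨q, hq⟩)
      (fun x hx y hxy hy => hS x hx y hxy (fun h => hy (Subtype.ext h))) hp
      (fun h => hpw (congrArg Subtype.val h)) (fun h => hqw (congrArg Subtype.val h))
  · exact (hB.1 ⟨p, hpB⟩ ⟨q, hq⟩).mem_of_closed (S := {x | (x : V) ∈ S}) hp
      (fun x hx y hxy => hS x hx y hxy (fun h => hw (h ▸ y.2)))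

lemma isNonseparable_of_card_eq_two {G : SimpleGraph V} (hG : G.Connected) (hV : Nat.card V = 2) :
    G.IsNonseparable := by
  obtain ⟨x, y, hxy, hu⟩ := Nat.card_eq_two_iff.1 hV
  refine ⟨hG, ⟨x, y, hxy⟩, fun w hw => ?_⟩
  obtain ⟨S, hwS, ⟨p, hp⟩, ⟨q, hq, hqw⟩, -⟩ := (hG.isCutVertex_iff w).1 hw
  have h (z : V) : z = x ∨ z = y := by simpa using hu.symm.subset (Set.mem_univ z)
  have hpq : p ≠ q := fun h => hq (h ▸ hp)
  have hpw : p ≠ w := fun h => hwS (h ▸ hp)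
  rcases h p with rfl | rfl <;> rcases h q with rfl | rfl <;> rcases h w with rfl | rfl <;> simp_all

lemma Preconnected.exists_adj [Nontrivial V] {G : SimpleGraph V} (h : G.Preconnected) (v : V) :
    ∃ w, G.Adj v w :=
  (mem_support G).1 (h.support_eq_univ ▸ Set.mem_univ v)

/-! ### Blocks, and the splitting of a two-block graph. -/

lemma Adj.exists_mem_blocks [Finite V] {G : SimpleGraph V} {a b : V} (h : G.Adj a b) :
    ∃ B ∈ G.blocks, a ∈ B.verts ∧ b ∈ B.verts := by
  have hns : (G.subgraphOfAdj h).coe.IsNonseparable :=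
    isNonseparable_of_card_eq_two (Subgraph.subgraphOfAdj_connected h).coe (by
      rw [subgraphOfAdj_verts, Nat.card_coe_set_eq, Set.ncard_pair h.ne])
  obtain ⟨B, hle, hB⟩ := Finite.exists_le_maximal (p := fun H : G.Subgraph => H.coe.IsNonseparable) hns
  exact ⟨B, hB, hle.1 (by simp), hle.1 (by simp)⟩

lemma IsNonseparable.blocks_eq {G : SimpleGraph V} (hG : G.IsNonseparable) : G.blocks = {⊤} := by
  have htop : (⊤ : G.Subgraph).coe.IsNonseparable := Subgraph.topIso.symm.isNonseparable hG
  ext B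
  refine ⟨fun hB => ?_, ?_⟩
  · exact top_le_iff.1 (hB.2 htop le_top)
  · rintro rfl
    exact ⟨htop, fun _ _ _ => le_top⟩

/-- If `S` and its complement in `{v}ᶜ` are nonadjacent in a connected graph with two blocks,
then `S ∪ {v}` induces a nonseparable graph. -/
lemma Connected.isNonseparable_induce_insert [Finite V] {G : SimpleGraph V} (hG : G.Connected)
    (hb : G.blocks.ncard = 2) {S : Set V} {v a b : V} (hv : v ∉ S) (ha : a ∈ S) (hbS : b ∉ S)
    (hbv : b ≠ v) (hS : ∀ x ∈ S, ∀ y, G.Adj x y → y ≠ v → y ∈ S) :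
    (G.induce (insert v S)).IsNonseparable := by
  have hsub : ∀ B ∈ G.blocks, ∀ p ∈ S, p ∈ B.verts → B.verts ⊆ insert v S := fun B hB p hp hpB =>
    Subgraph.verts_subset_insert_of_closed hB.1 (fun x hx y hxy => hS x hx y hxy.adj_sub) hp hpB
      (fun h => hv (h ▸ hp))
  have hconn : (G.induce (insert v S)).Connected := by
    rw [connected_iff_exists_forall_reachable]
    refine ⟨⟨v, Or.inl rfl⟩, fun x => ?_⟩
    by_contra hx
    -- A walk in `G` from `x` cannot leave `insert v S` before visiting `v`, so closure of `R` needs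
    -- checking only while `v` is not reached.
    let R : Set V := {y | ∃ hy : y ∈ insert v S, (G.induce (insert v S)).Reachable x ⟨y, hy⟩}
    have hvR : v ∈ R := by
      refine (hG x v).mem_of_closed (S := R) ⟨x.2, Reachable.refl _⟩ ?_
      rintro y ⟨hy, hr⟩ z hyz
      have hyv : y ≠ v := by
        rintro rfl
        exact hx hr.symm
      have hz : z ∈ insert v S := by
        by_cases hzv : z = v
        · exact Or.inl hzv
        · exact Or.inr (hS y (hy.resolve_left hyv) z hyz hzv)
      exact ⟨hz, hr.trans (Adj.reachable (by simpa using hyz))⟩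
    obtain ⟨_, h⟩ := hvR
    exact hx h.symm
  have hnt : Nontrivial ↥(insert v S) :=
    ⟨⟨v, Or.inl rfl⟩, ⟨a, Or.inr ha⟩, fun h => hv (by
      rwa [show v = a from congrArg Subtype.val h])⟩
  refine ⟨hconn, hnt, fun w hw => ?_⟩
  obtain ⟨P, hwP, ⟨p, hp⟩, ⟨q, hq, hqw⟩, hP⟩ := (hconn.isCutVertex_iff w).1 hw
  have hblock : ∀ x : ↥(insert v S), ∃ B ∈ G.blocks, (x : V) ∈ B.verts ∧ B.verts ⊆ insert v S := by
    intro x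
    obtain ⟨y, hy⟩ := hconn.preconnected.exists_adj x
    have hxy : G.Adj x y := by simpa using hy
    obtain ⟨B, hB, hxB, hyB⟩ := hxy.exists_mem_blocks
    refine ⟨B, hB, hxB, ?_⟩
    rcases x.2 with hx | hx
    · exact hsub B hB y (y.2.resolve_left fun h => hxy.ne (hx.trans h.symm)) hyB
    · exact hsub B hB x hx hxB
  -- A cut-vertex `w` inside the piece would give three distinct blocks: two in the piece, through
  -- `p` and `q`, and one through `b`.
  obtain ⟨Bp, hBp, hpB, hBpS⟩ := hblock p
  obtain ⟨Bq, hBq, hqB, hBqS⟩ := hblock q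
  have : Nontrivial V := ⟨b, v, hbv⟩
  obtain ⟨c, hc⟩ := hG.preconnected.exists_adj b
  obtain ⟨Bb, hBb, hbB, -⟩ := hc.exists_mem_blocks
  have h1 : Bb ≠ Bp := by
    rintro rfl
    exact (hBpS hbB).elim hbv hbS
  have h2 : Bb ≠ Bq := by
    rintro rfl
    exact (hBqS hbB).elim hbv hbS
  have h3 : Bp ≠ Bq := by
    rintro rfl
    have := Subgraph.verts_subset_insert_of_closed hBp.1 (S := (↑) '' P) (w := w) (p := p)
      (by
        rintro _ ⟨x, hx, rfl⟩ y hxy hy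
        exact ⟨⟨y, hBpS hxy.snd_mem⟩, hP x hx _ (by simpa using hxy.adj_sub)
          (fun h => hy (congrArg Subtype.val h)), rfl⟩)
      ⟨p, hp, rfl⟩ hpB (fun h => hwP (Subtype.ext h ▸ hp))
    rcases this hqB with h | ⟨x, hx, h⟩
    · exact hqw (Subtype.ext h)
    · exact hq (Subtype.ext h ▸ hx)
  have h4 : ({Bb, Bp, Bq} : Set G.Subgraph) ⊆ G.blocks := by
    rintro B (rfl | rfl | rfl) <;> assumption
  have h5 := Set.ncard_le_ncard h4 (Set.toFinite _)
  rw [Set.ncard_eq_three.2 ⟨Bb, Bp, Bq, h1, h2, h3, rfl⟩] at h5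
  omega

/-- A connected graph with two blocks is the union of two nonseparable induced subgraphs sharing
a single vertex. -/
lemma Connected.exists_isNonseparable_pair [Finite V] [Nontrivial V] {G : SimpleGraph V}
    (hG : G.Connected) (hb : G.blocks.ncard = 2) :
    ∃ (v : V) (S : Set V), v ∉ S ∧ (G.induce (insert v S)).IsNonseparable ∧
      (G.induce Sᶜ).IsNonseparable := by
  by_cases hcut : ∃ v, G.IsCutVertex v
  · obtain ⟨v, hv⟩ := hcut
    obtain ⟨S, hvS, ⟨p, hp⟩, ⟨q, hq, hqv⟩, hS⟩ := (hG.isCutVertex_iff v).1 hv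
    refine ⟨v, S, hvS, hG.isNonseparable_induce_insert hb hvS hp hq hqv hS, ?_⟩
    -- The far side of `v` is closed too, so the same lemma applies with the roles exchanged.
    have hT : Sᶜ = insert v (insert v S)ᶜ := by
      ext x
      by_cases hx : x = v <;> simp [hx, hvS]
    rw [hT]
    refine hG.isNonseparable_induce_insert hb (a := q) (b := p) (by simp) (by simp [hq, hqv])
      (by simp [hp]) (fun h => hvS (h ▸ hp)) fun x hx y hxy hy => ?_
    have hxv : x ≠ v := fun h => hx (Or.inl h)
    rintro (h | h)
    · exact hy h
    · exact hx (Or.inr (hS y h x hxy.symm hxv))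
  · push Not at hcut
    rw [IsNonseparable.blocks_eq ⟨hG, inferInstance, hcut⟩] at hb
    simp at hb

/-! ### Distance sums in nonseparable graphs. -/

lemma two_mul_wienerIndex [Fintype V] (G : SimpleGraph V) :
    2 * G.wienerIndex = ∑ x, ∑ y, G.dist x y := by
  classical
  let f : Sym2 V → ℕ := Sym2.lift ⟨fun a b => G.dist a b, fun _ _ => G.dist_comm⟩
  have hf : G.wienerIndex = ∑ e, f e := rfl
  rw [hf, ← Fintype.sum_prod_type', Finset.mul_sum,
    ← Finset.sum_fiberwise (s := Finset.univ) (g := fun p : V × V => s(p.1, p.2))]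
  refine Finset.sum_congr rfl fun e _ => ?_
  induction e using Sym2.ind with
  | _ a b =>
    have hfib : ({p : V × V | s(p.1, p.2) = s(a, b)} : Finset (V × V)) = {(a, b), (b, a)} := by
      ext ⟨x, y⟩
      simp
    rw [hfib]
    by_cases hab : a = b
    · subst hab
      simp [f]
    · rw [Finset.sum_pair (by simp [hab])]
      simp [f, G.dist_comm (u := b), two_mul]

lemma Adj.dist_le_dist_add_one {G : SimpleGraph V} {y z : V} (h : G.Adj y z) (hG : G.Connected)
    (x : V) : G.dist x z ≤ G.dist x y + 1 := by
  have := hG.dist_triangle (u := x) (v := y) (w := z)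
  rwa [dist_eq_one_iff_adj.2 h] at this

/-- In a nonseparable graph, every distance level below the eccentricity has at least two
vertices. -/
lemma IsNonseparable.two_le_card_dist_eq [Fintype V] {G : SimpleGraph V} (hG : G.IsNonseparable)
    (x : V) {i : ℕ} (hi : 0 < i) {z : V} (hz : i < G.dist x z) :
    2 ≤ (Finset.univ.filter fun y => G.dist x y = i).card := by
  by_contra! hlt
  have hle : (Finset.univ.filter fun y => G.dist x y = i).card ≤ 1 := by omega
  rw [Finset.card_le_one] at hle
  simp only [Finset.mem_filter, Finset.mem_univ, true_and] at hle
  -- Distance grows by at most one along an edge, so a level with a single vertex would separate `x`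
  -- from `z`, and an empty level would disconnect them.
  by_cases hw : ∃ w, G.dist x w = i
  · obtain ⟨w, hw⟩ := hw
    have : z ∈ {y | G.dist x y < i} := by
      refine hG.mem_of_closed (w := w) (p := x) ?_ (by simpa using hi) ?_ ?_
      · intro y hy y' hyy' hy'
        have h1 := hyy'.dist_le_dist_add_one hG.1 x
        have h2 : G.dist x y' ≠ i := fun h => hy' (hle _ h _ hw)
        simp only [Set.mem_ofPred_eq] at hy ⊢
        omega
      · rintro rfl
        simp at hw
        omega
      · rintro rfl
        omega
    simp only [Set.mem_ofPred_eq] at this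
    omega
  · have : z ∈ {y | G.dist x y < i} := by
      refine (hG.1 x z).mem_of_closed (by simpa using hi) ?_
      intro y hy y' hyy'
      have h1 := hyy'.dist_le_dist_add_one hG.1 x
      have h2 : G.dist x y' ≠ i := fun h => hw ⟨_, h⟩
      simp only [Set.mem_ofPred_eq] at hy ⊢
      omega
    simp only [Set.mem_ofPred_eq] at this
    omega

lemma IsNonseparable.card_lt_dist_le [Fintype V] {G : SimpleGraph V} (hG : G.IsNonseparable)
    (x : V) (i : ℕ) :
    (Finset.univ.filter fun y => i < G.dist x y).card ≤ Fintype.card V - 1 - 2 * i := by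
  classical
  induction i with
  | zero =>
    have : (Finset.univ.filter fun y => 0 < G.dist x y) ⊆ Finset.univ.erase x := by
      intro y hy
      rw [Finset.mem_erase]
      refine ⟨?_, Finset.mem_univ _⟩
      rintro rfl
      simp at hy
    simpa using Finset.card_le_card this
  | succ i ih =>
    rcases (Finset.univ.filter fun y => i + 1 < G.dist x y).eq_empty_or_nonempty with h | ⟨z, hz⟩
    · simp [h]
    have h2 := hG.two_le_card_dist_eq x i.succ_pos (by simpa using hz)
    have h3 : (Finset.univ.filter fun y => i < G.dist x y).card =
        (Finset.univ.filter fun y => G.dist x y = i + 1).card +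
          (Finset.univ.filter fun y => i + 1 < G.dist x y).card := by
      rw [← Finset.card_union_of_disjoint]
      · congr 1
        ext y
        simp only [Finset.mem_filter, Finset.mem_univ, true_and, Finset.mem_union]
        omega
      · rw [Finset.disjoint_filter]
        intros
        omega
    have : 0 < (Finset.univ.filter fun y => i + 1 < G.dist x y).card := Finset.card_pos.2 ⟨z, hz⟩
    simp only [Nat.succ_eq_add_one] at h2
    omega

/-- The sum `(m - 1) + (m - 3) + ⋯` loses its first term when `m` drops by two. Truncated
subtraction makes later terms zero, so `N` is arbitrary. -/
lemma _root_.Finset.sum_range_sub_one_sub_two_mul (m N : ℕ) :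
    ∑ i ∈ Finset.range N, (m - 1 - 2 * i) ≤ m ^ 2 / 4 := by
  induction N generalizing m with
  | zero => simp
  | succ N ih =>
    rw [Finset.sum_range_succ']
    rcases m with _ | _ | m
    · simp
    · simp
    have := ih m
    have h : ∀ i, m + 1 + 1 - 1 - 2 * (i + 1) = m - 1 - 2 * i := by omega
    simp only [h]
    have h2 : (m + 1 + 1) ^ 2 = m ^ 2 + (m + 1) * 4 := by ring
    rw [h2, Nat.add_mul_div_right _ _ (by norm_num)]
    omega

/-- The distances from a vertex of a nonseparable graph on `m` vertices sum to at most
`⌊m² / 4⌋`. -/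
lemma IsNonseparable.sum_dist_le [Fintype V] {G : SimpleGraph V} (hG : G.IsNonseparable) (x : V) :
    ∑ y, G.dist x y ≤ Fintype.card V ^ 2 / 4 := by
  classical
  obtain ⟨N, hN⟩ : ∃ N, ∀ y, G.dist x y ≤ N :=
    ⟨∑ y, G.dist x y, fun y => Finset.single_le_sum (f := fun y => G.dist x y)
      (fun _ _ => Nat.zero_le _) (Finset.mem_univ y)⟩
  -- Layer-cake summation: each distance counts the thresholds `i` below it.
  calc ∑ y, G.dist x y = ∑ y, ∑ i ∈ Finset.range N, if i < G.dist x y then 1 else 0 := by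
        refine Finset.sum_congr rfl fun y _ => ?_
        rw [← Finset.card_filter]
        have : (Finset.range N).filter (fun i => i < G.dist x y) = Finset.range (G.dist x y) := by
          ext i
          have := hN y
          simp only [Finset.mem_filter, Finset.mem_range]
          omega
        rw [this, Finset.card_range]
    _ = ∑ i ∈ Finset.range N, (Finset.univ.filter fun y => i < G.dist x y).card := by
        rw [Finset.sum_comm]
        simp only [Finset.card_filter]
    _ ≤ ∑ i ∈ Finset.range N, (Fintype.card V - 1 - 2 * i) :=
        Finset.sum_le_sum fun i _ => hG.card_lt_dist_le x i
    _ ≤ _ := Finset.sum_range_sub_one_sub_two_mul _ _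

lemma dist_map_le {G : SimpleGraph V} {H : SimpleGraph W} (f : G →g H) {a b : V}
    (h : G.Reachable a b) : H.dist (f a) (f b) ≤ G.dist a b := by
  obtain ⟨p, hp⟩ := h.exists_walk_length_eq_dist
  rw [← hp, ← Walk.length_map f p]
  exact dist_le _

/-! ### Upper bound for two nonseparable pieces. -/

lemma IsNonseparable.sum_dist_le_of_induce {G : SimpleGraph V} {A : Finset V}
    (hA : (G.induce (A : Set V)).IsNonseparable) {x : V} (hx : x ∈ A) :
    ∑ y ∈ A, G.dist x y ≤ A.card ^ 2 / 4 := by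
  have h := hA.sum_dist_le ⟨x, hx⟩
  have hc : Fintype.card ↥(A : Set V) = A.card := by simp
  rw [hc] at h
  refine le_trans ?_ h
  rw [← Finset.sum_coe_sort A]
  exact Finset.sum_le_sum fun y _ => dist_map_le (Embedding.induce (A : Set V)).toHom (hA.1 ⟨x, hx⟩ y)

/-- Equality holds at `p = 1` and at `q = 1`. Splitting by parity removes the floors; after shifting
even arguments to start at 2, the difference of the sides is a polynomial with nonnegative
coefficients. -/
lemma _root_.Nat.wiener_two_blocks_le (p q : ℕ) (hp : 1 ≤ p) (hq : 1 ≤ q) :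
    (p + 1 + 2 * q) * ((p + 1) ^ 2 / 4) + (q + 1 + 2 * p) * ((q + 1) ^ 2 / 4) ≤
      (p + q + 2) * ((p + q) ^ 2 / 4) + 2 * (p + q) := by
  have heven : ∀ k : ℕ, (2 * k) ^ 2 / 4 = k ^ 2 := fun k => by
    rw [show (2 * k) ^ 2 = k ^ 2 * 4 by ring, Nat.mul_div_cancel _ (by norm_num)]
  have hodd : ∀ k : ℕ, (2 * k + 1) ^ 2 / 4 = k ^ 2 + k := fun k => by
    rw [show (2 * k + 1) ^ 2 = 1 + (k ^ 2 + k) * 4 by ring,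
      Nat.add_mul_div_right _ _ (by norm_num)]
    norm_num
  rcases Nat.even_or_odd' p with ⟨a, rfl | rfl⟩ <;> rcases Nat.even_or_odd' q with ⟨b, rfl | rfl⟩
  · obtain ⟨a, rfl⟩ : ∃ c, a = c + 1 := ⟨a - 1, by omega⟩
    obtain ⟨b, rfl⟩ : ∃ c, b = c + 1 := ⟨b - 1, by omega⟩
    rw [hodd, hodd, show 2 * (a + 1) + 2 * (b + 1) = 2 * (a + b + 2) by ring, heven]
    ring_nf
    nlinarith [Nat.zero_le (a * b), Nat.zero_le (a * a * b), Nat.zero_le (a * b * b)]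
  · obtain ⟨a, rfl⟩ : ∃ c, a = c + 1 := ⟨a - 1, by omega⟩
    rw [hodd, show 2 * b + 1 + 1 = 2 * (b + 1) by ring, heven,
      show 2 * (a + 1) + (2 * b + 1) = 2 * (a + 1 + b) + 1 by ring, hodd]
    ring_nf
    nlinarith [Nat.zero_le (a * b), Nat.zero_le (a * a * b), Nat.zero_le (a * b * b)]
  · obtain ⟨b, rfl⟩ : ∃ c, b = c + 1 := ⟨b - 1, by omega⟩
    rw [hodd, show 2 * a + 1 + 1 = 2 * (a + 1) by ring, heven,
      show 2 * a + 1 + (2 * (b + 1)) = 2 * (a + 1 + b) + 1 by ring, hodd]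
    ring_nf
    nlinarith [Nat.zero_le (a * b), Nat.zero_le (a * a * b), Nat.zero_le (a * b * b)]
  · rw [show 2 * a + 1 + 1 = 2 * (a + 1) by ring, show 2 * b + 1 + 1 = 2 * (b + 1) by ring,
      heven, heven, show 2 * a + 1 + (2 * b + 1) = 2 * (a + b + 1) by ring, heven]
    ring_nf
    nlinarith [Nat.zero_le (a * b), Nat.zero_le (a * a * b), Nat.zero_le (a * b * b)]

lemma Connected.sum_sum_dist_le {G : SimpleGraph V} (hG : G.Connected) (v : V) (S T : Finset V) :
    ∑ x ∈ S, ∑ y ∈ T, G.dist x y ≤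
      T.card * ∑ x ∈ S, G.dist v x + S.card * ∑ y ∈ T, G.dist v y := by
  calc _ ≤ ∑ x ∈ S, ∑ y ∈ T, (G.dist v x + G.dist v y) := by
        refine Finset.sum_le_sum fun x _ => Finset.sum_le_sum fun y _ => ?_
        rw [G.dist_comm (u := v) (v := x)]
        exact hG.dist_triangle
    _ = _ := by
        simp only [Finset.sum_add_distrib, Finset.sum_const, smul_eq_mul, Finset.mul_sum]

/-- Upper bound for the Wiener index of a graph that is the union of two nonseparable induced
subgraphs on `p + 1` and `q + 1` vertices sharing a single vertex. -/
lemma Connected.two_mul_wienerIndex_le [Fintype V] [DecidableEq V] {G : SimpleGraph V}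
    (hG : G.Connected) {v : V} {S T : Finset V} (hvS : v ∉ S) (hvT : v ∉ T) (hST : Disjoint S T)
    (huniv : insert v (S ∪ T) = Finset.univ)
    (hS : (G.induce (insert v S : Finset V)).IsNonseparable)
    (hT : (G.induce (insert v T : Finset V)).IsNonseparable) :
    2 * G.wienerIndex ≤ (S.card + 1 + 2 * T.card) * ((S.card + 1) ^ 2 / 4) +
      (T.card + 1 + 2 * S.card) * ((T.card + 1) ^ 2 / 4) := by
  have hsum : ∀ f : V → ℕ, ∑ x, f x = f v + ∑ x ∈ S, f x + ∑ x ∈ T, f x := fun f => by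
    rw [← huniv, Finset.sum_insert (by simp [hvS, hvT]), Finset.sum_union hST, add_assoc]
  have hA : ∀ x ∈ insert v S, G.dist x v + ∑ y ∈ S, G.dist x y ≤ (S.card + 1) ^ 2 / 4 := by
    intro x hx
    have := hS.sum_dist_le_of_induce hx
    rwa [Finset.sum_insert hvS, Finset.card_insert_of_notMem hvS] at this
  have hB : ∀ x ∈ insert v T, G.dist x v + ∑ y ∈ T, G.dist x y ≤ (T.card + 1) ^ 2 / 4 := by
    intro x hx
    have := hT.sum_dist_le_of_induce hx
    rwa [Finset.sum_insert hvT, Finset.card_insert_of_notMem hvT] at this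
  have hvA := hA v (by simp)
  have hvB := hB v (by simp)
  simp only [dist_self, zero_add] at hvA hvB
  have hSA : ∑ x ∈ S, (G.dist x v + ∑ y ∈ S, G.dist x y) ≤ S.card * ((S.card + 1) ^ 2 / 4) := by
    simpa using Finset.sum_le_card_nsmul S _ _ fun x hx => hA x (Finset.mem_insert_of_mem hx)
  have hTB : ∑ x ∈ T, (G.dist x v + ∑ y ∈ T, G.dist x y) ≤ T.card * ((T.card + 1) ^ 2 / 4) := by
    simpa using Finset.sum_le_card_nsmul T _ _ fun x hx => hB x (Finset.mem_insert_of_mem hx)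
  have hcross := hG.sum_sum_dist_le v S T
  have hcross' := hG.sum_sum_dist_le v T S
  have h1 := Nat.mul_le_mul_left T.card hvA
  have h2 := Nat.mul_le_mul_left S.card hvB
  rw [two_mul_wienerIndex]
  simp only [hsum, dist_self]
  simp only [Finset.sum_add_distrib] at hSA hTB ⊢
  linarith

theorem Connected.two_mul_wienerIndex_le_of_ncard_blocks [Fintype V] {G : SimpleGraph V}
    (hG : G.Connected) (hb : G.blocks.ncard = 2) {m : ℕ} (hm : Fintype.card V = m + 1)
    (hm1 : 1 ≤ m) : 2 * G.wienerIndex ≤ (m + 2) * (m ^ 2 / 4) + 2 * m := by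
  classical
  have : Nontrivial V := Fintype.one_lt_card_iff_nontrivial.1 (by omega)
  obtain ⟨v, S, hv, hS, hT⟩ := hG.exists_isNonseparable_pair hb
  have hSpos : 1 ≤ S.toFinset.card := by
    obtain ⟨x, hx⟩ := @exists_ne _ hS.2.1 ⟨v, Or.inl rfl⟩
    exact Finset.card_pos.2 ⟨x, by simpa using x.2.resolve_left fun h => hx (Subtype.ext h)⟩
  set T : Finset V := (insert v S.toFinset)ᶜ with hTdef
  have hTpos : 1 ≤ T.card := by
    obtain ⟨x, hx⟩ := @exists_ne _ hT.2.1 ⟨v, hv⟩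
    refine Finset.card_pos.2 ⟨x, ?_⟩
    have h1 : (x : V) ∉ S := x.2
    have h2 : (x : V) ≠ v := fun h => hx (Subtype.ext h)
    simpa [hTdef, h2] using h1
  have hcard : S.toFinset.card + T.card = m := by
    have h : _ + T.card = _ := Finset.card_add_card_compl (insert v S.toFinset)
    rw [Finset.card_insert_of_notMem (by simpa using hv), hm] at h
    omega
  have hset1 : ((insert v S.toFinset : Finset V) : Set V) = insert v S := by simp
  have hset2 : ((insert v T : Finset V) : Set V) = Sᶜ := by
    ext x
    by_cases hx : x = v <;> simp [hTdef, hx, hv]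
  refine (hG.two_mul_wienerIndex_le (v := v) (S := S.toFinset) (T := T) (by simpa using hv)
    (by simp [hTdef]) ?_ ?_ (by rw [hset1]; exact hS) (by rw [hset2]; exact hT)).trans ?_
  · rw [Finset.disjoint_left]
    intro x hx
    simp_all
  · ext x
    by_cases hx : x = v <;> by_cases hxS : x ∈ S <;> simp [hTdef, hx, hxS]
  · rw [← hcard]
    exact Nat.wiener_two_blocks_le _ _ hSpos hTpos

/-! ### The coalescence and its blocks. -/

section coalescence

variable (G : SimpleGraph V) (u : V) (H : SimpleGraph W) (w : W)

/-- The inclusion of the first factor into the coalescence. -/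
def coalescenceInl : G ↪g G.coalescence u H w where
  toFun := Sum.inl
  inj' := Sum.inl_injective
  map_rel_iff' := Iff.rfl

open Classical in
/-- The map from the second factor into the coalescence, sending `w` to `u`. -/
noncomputable def coalescenceInrFun (u : V) (w : W) (y : W) : V ⊕ {y : W // y ≠ w} :=
  if h : y = w then Sum.inl u else Sum.inr ⟨y, h⟩

lemma coalescenceInrFun_self : coalescenceInrFun u w w = Sum.inl u := dif_pos rfl

lemma coalescenceInrFun_of_ne {y : W} (h : y ≠ w) : coalescenceInrFun u w y = Sum.inr ⟨y, h⟩ :=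
  dif_neg h

/-- The inclusion of the second factor into the coalescence, sending `w` to `u`. -/
noncomputable def coalescenceInr : H ↪g G.coalescence u H w where
  toFun := coalescenceInrFun u w
  inj' x y h := by
    by_cases hx : x = w <;> by_cases hy : y = w
    · rw [hx, hy]
    · rw [hx, coalescenceInrFun_self, coalescenceInrFun_of_ne u w hy] at h
      exact absurd h Sum.inl_ne_inr
    · rw [hy, coalescenceInrFun_self, coalescenceInrFun_of_ne u w hx] at h
      exact absurd h Sum.inr_ne_inl
    · rw [coalescenceInrFun_of_ne u w hx, coalescenceInrFun_of_ne u w hy] at h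
      exact congrArg Subtype.val (Sum.inr_injective h)
  map_rel_iff' := by
    intro x y
    change (G.coalescence u H w).Adj (coalescenceInrFun u w x) (coalescenceInrFun u w y) ↔ _
    by_cases hx : x = w <;> by_cases hy : y = w
    · subst hx hy
      simp
    · subst hx
      rw [coalescenceInrFun_self, coalescenceInrFun_of_ne u x hy]
      simp [coalescence]
    · subst hy
      rw [coalescenceInrFun_self, coalescenceInrFun_of_ne u y hx]
      simp [coalescence, H.adj_comm y x]
    · rw [coalescenceInrFun_of_ne u w hx, coalescenceInrFun_of_ne u w hy]
      rfl

lemma coalescenceInr_self : G.coalescenceInr u H w w = Sum.inl u := coalescenceInrFun_self u w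

lemma coalescenceInr_of_ne {y : W} (h : y ≠ w) : G.coalescenceInr u H w y = Sum.inr ⟨y, h⟩ :=
  coalescenceInrFun_of_ne u w h

lemma range_coalescenceInr :
    Set.range (G.coalescenceInr u H w) = insert (Sum.inl u) (Set.range Sum.inr) := by
  ext x
  constructor
  · rintro ⟨y, rfl⟩
    by_cases hy : y = w
    · rw [hy, coalescenceInr_self]
      exact Or.inl rfl
    · rw [coalescenceInr_of_ne G u H w hy]
      exact Or.inr ⟨_, rfl⟩
  · rintro (rfl | ⟨⟨y, hy⟩, rfl⟩)
    · exact ⟨w, coalescenceInr_self G u H w⟩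
    · exact ⟨y, coalescenceInr_of_ne G u H w hy⟩

variable {G H}

lemma Connected.coalescence (hG : G.Connected) (hH : H.Connected) :
    (G.coalescence u H w).Connected := by
  rw [connected_iff_exists_forall_reachable]
  refine ⟨Sum.inl u, ?_⟩
  rintro (x | y)
  · exact (hG u x).map (G.coalescenceInl u H w).toHom
  · have := (hH w y).map (G.coalescenceInr u H w).toHom
    rwa [show (G.coalescenceInr u H w).toHom w = _ from coalescenceInr_self G u H w,
      show (G.coalescenceInr u H w).toHom y = _ from coalescenceInr_of_ne G u H w y.2] at this

end coalescence

/-- If two nonseparable induced subgraphs share exactly the vertex `v`, cover the graph, and are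
nonadjacent outside `v`, then they are the two blocks. -/
lemma ncard_blocks_eq_two {G : SimpleGraph V} {v : V} {S : Set V} (hv : v ∉ S)
    (hS : ∀ x ∈ S, ∀ y, G.Adj x y → y ≠ v → y ∈ S)
    (hA : (G.induce (insert v S)).IsNonseparable) (hB : (G.induce Sᶜ).IsNonseparable) :
    G.blocks.ncard = 2 := by
  set X := (⊤ : G.Subgraph).induce (insert v S) with hX
  set Y := (⊤ : G.Subgraph).induce Sᶜ with hY
  have hXn : X.coe.IsNonseparable := by
    rwa [induce_eq_coe_induce_top] at hA
  have hYn : Y.coe.IsNonseparable := by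
    rwa [induce_eq_coe_induce_top] at hB
  -- Every nonseparable subgraph lies on one side of `v`, so `X` and `Y` are the only candidates for
  -- maximality.
  have hle : ∀ H : G.Subgraph, H.coe.IsNonseparable → H ≤ X ∨ H ≤ Y := by
    intro H hH
    have hsub : H.verts ⊆ insert v S ∨ H.verts ⊆ Sᶜ := by
      by_cases h : ∃ p ∈ H.verts, p ∈ S
      · obtain ⟨p, hpH, hpS⟩ := h
        exact Or.inl (Subgraph.verts_subset_insert_of_closed hH
          (fun x hx y hxy => hS x hx y hxy.adj_sub) hpS hpH (fun h => hv (h ▸ hpS)))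
      · push Not at h
        exact Or.inr h
    exact hsub.imp (fun h => Subgraph.le_induce_top_verts.trans (Subgraph.induce_mono_right h))
      (fun h => Subgraph.le_induce_top_verts.trans (Subgraph.induce_mono_right h))
  have hXY : ¬ X ≤ Y := by
    intro h
    obtain ⟨x, hx⟩ := @exists_ne _ hA.2.1 ⟨v, Or.inl rfl⟩
    exact h.1 x.2 (x.2.resolve_left fun h => hx (Subtype.ext h))
  have hYX : ¬ Y ≤ X := by
    intro h
    obtain ⟨x, hx⟩ := @exists_ne _ hB.2.1 ⟨v, hv⟩
    exact (h.1 x.2).elim (fun h => hx (Subtype.ext h)) x.2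
  rw [Set.ncard_eq_two]
  refine ⟨X, Y, fun h => hXY h.le, ?_⟩
  ext B
  constructor
  · intro hB
    exact (hle B hB.1).imp (fun h => h.antisymm (hB.2 hXn h)) (fun h => h.antisymm (hB.2 hYn h))
  · rintro (rfl | rfl)
    · exact ⟨hXn, fun H hH hXH => (hle H hH).resolve_right fun h => hXY (hXH.trans h)⟩
    · exact ⟨hYn, fun H hH hYH => (hle H hH).resolve_left fun h => hYX (hYH.trans h)⟩

lemma IsNonseparable.ncard_blocks_coalescence {G : SimpleGraph V} {H : SimpleGraph W}
    (hG : G.IsNonseparable) (hH : H.IsNonseparable) (u : V) (w : W) :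
    (G.coalescence u H w).blocks.ncard = 2 := by
  refine ncard_blocks_eq_two (v := Sum.inl u) (S := Set.range Sum.inr) (by simp) ?_ ?_ ?_
  · rintro _ ⟨x, rfl⟩ (y | y) hxy hy
    · exact absurd (congrArg Sum.inl hxy.1) hy
    · simp
  · have := (G.coalescenceInr u H w).isoInduceRange.isNonseparable hH
    rwa [range_coalescenceInr] at this
  · have := (G.coalescenceInl u H w).isoInduceRange.isNonseparable hG
    have h : Set.range (G.coalescenceInl u H w) = (Set.range Sum.inr)ᶜ := by
      rw [Set.compl_range_inr]
      rfl
    rwa [h] at this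

/-! ### Cycles, and the Wiener index of a cycle with a pendant edge. -/

lemma cycleGraph_adj_add_one {n : ℕ} (x : Fin (n + 2)) : (cycleGraph (n + 2)).Adj x (x + 1) := by
  simp [cycleGraph_adj]

open Fin.NatCast in
lemma cycleGraph_isNonseparable (n : ℕ) : (cycleGraph (n + 2)).IsNonseparable := by
  refine ⟨cycleGraph_connected, inferInstance, fun w hw => ?_⟩
  obtain ⟨S, hwS, ⟨p, hp⟩, ⟨q, hq, hqw⟩, hS⟩ := (cycleGraph_connected.isCutVertex_iff w).1 hw
  have hne : ∀ j : ℕ, j + 1 < n + 2 → w + ((j + 1 : ℕ) : Fin (n + 2)) ≠ w := by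
    intro j hj h
    rw [add_eq_left, Fin.natCast_eq_zero] at h
    exact absurd (Nat.le_of_dvd j.succ_pos h) (by omega)
  -- Going round from `w + 1` without meeting `w`, membership in `S` never changes, so `S` is all of
  -- `{w}ᶜ` or empty.
  have hP : ∀ j : ℕ, j + 1 < n + 2 → (w + ((j + 1 : ℕ) : Fin (n + 2)) ∈ S ↔ w + 1 ∈ S) := by
    intro j
    induction j with
    | zero => simp
    | succ j ih =>
      intro hj
      rw [← ih (by omega)]
      have hadj := cycleGraph_adj_add_one (w + ((j + 1 : ℕ) : Fin (n + 2)))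
      rw [add_assoc, show ((j + 1 : ℕ) : Fin (n + 2)) + 1 = ((j + 1 + 1 : ℕ) : Fin (n + 2)) from
        Fin.ext (by simp [Fin.val_add])] at hadj
      exact ⟨fun h => hS _ h _ hadj.symm (hne j (by omega)),
        fun h => hS _ h _ hadj (hne (j + 1) hj)⟩
  have hmem : ∀ x, x ≠ w → (x ∈ S ↔ w + 1 ∈ S) := by
    intro x hx
    have h0 : (x - w).val ≠ 0 := by
      rw [Fin.val_ne_zero_iff]
      exact sub_ne_zero.2 hx
    have h1 := hP ((x - w).val - 1) (by have := (x - w).isLt; omega)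
    rw [show (x - w).val - 1 + 1 = (x - w).val by omega, Fin.cast_val_eq_self,
      add_sub_cancel] at h1
    exact h1
  exact hq ((hmem q hqw).2 ((hmem p (fun h => hwS (h ▸ hp))).1 hp))

/-- An integer potential rising by at most one per edge bounds distance from below, with no need to
analyse shortest paths. -/
lemma Reachable.le_add_dist {G : SimpleGraph V} {a b : V} (h : G.Reachable a b) {f : V → ℕ}
    (hf : ∀ x y, G.Adj x y → f y ≤ f x + 1) : f b ≤ f a + G.dist a b := by
  obtain ⟨p, hp⟩ := h.exists_walk_length_eq_dist
  rw [← hp]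
  clear hp h
  induction p with
  | nil => simp
  | cons hxy p ih =>
    have := hf _ _ hxy
    rw [Walk.length_cons]
    omega

/-- The distance from `0` to `d` in a cycle of length `m`. -/
def cycleDist {m : ℕ} (d : Fin m) : ℕ := min d.val (m - d.val)

lemma cycleDist_zero {m : ℕ} : cycleDist (0 : Fin (m + 1)) = 0 := by simp [cycleDist]

lemma cycleDist_sub_le_of_adj {n : ℕ} {y z : Fin (n + 2)} (h : (cycleGraph (n + 2)).Adj y z)
    (x : Fin (n + 2)) : cycleDist (z - x) ≤ cycleDist (y - x) + 1 := by
  have key : ∀ d : Fin (n + 2), cycleDist (d + 1) ≤ cycleDist d + 1 ∧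
      cycleDist d ≤ cycleDist (d + 1) + 1 := by
    intro d
    have := d.isLt
    simp only [cycleDist, Fin.val_add_one]
    split_ifs with hd
    · subst hd
      simp
    · omega
  rw [cycleGraph_adj] at h
  rcases h with h | h
  · obtain rfl : y = z + 1 := by rw [← h]; abel
    rw [show z + 1 - x = z - x + 1 by abel]
    exact (key _).2
  · obtain rfl : z = y + 1 := by rw [← h]; abel
    rw [show y + 1 - x = y - x + 1 by abel]
    exact (key _).1

lemma _root_.Finset.sum_range_min_sub (m : ℕ) :
    ∑ k ∈ Finset.range m, min k (m - k) = m ^ 2 / 4 := by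
  induction m using Nat.twoStepInduction with
  | zero => simp
  | one => simp
  | more m ih _ =>
    rw [Finset.sum_range_succ', Finset.sum_range_succ]
    have h : ∀ k ∈ Finset.range m, min (k + 1) (m + 2 - (k + 1)) = min k (m - k) + 1 := by
      intro k hk
      rw [Finset.mem_range] at hk
      omega
    rw [Finset.sum_congr rfl h, Finset.sum_add_distrib, ih,
      show (m + 2) ^ 2 = m ^ 2 + (m + 1) * 4 by ring, Nat.add_mul_div_right _ _ (by norm_num)]
    simp
    omega

lemma sum_cycleDist_sub {m : ℕ} (x : Fin (m + 1)) :
    ∑ y, cycleDist (y - x) = (m + 1) ^ 2 / 4 := by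
  rw [show ∑ y, cycleDist (y - x) = _ from (Equiv.subRight x).sum_comp cycleDist, ← Finset.sum_range_min_sub]
  exact Fin.sum_univ_eq_sum_range (fun k => min k (m + 1 - k)) (m + 1)

lemma le_two_mul_wienerIndex_coalescence (n : ℕ) (u : Fin (n + 2)) (w : Fin 2) :
    (n + 4) * ((n + 2) ^ 2 / 4) + 2 * (n + 2) ≤
      2 * ((cycleGraph (n + 2)).coalescence u (cycleGraph 2) w).wienerIndex := by
  set K := (cycleGraph (n + 2)).coalescence u (cycleGraph 2) w
  have hconn : K.Connected := cycleGraph_connected.coalescence u w cycleGraph_connected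
  have hcycle : ∀ x y, cycleDist (y - x) ≤ K.dist (.inl x) (.inl y) := by
    intro x y
    have := (hconn (.inl x) (.inl y)).le_add_dist
      -- The pendant vertex takes the value at its neighbour `u`, so the pendant edge offers no
      -- shortcut.
      (f := Sum.elim (fun y => cycleDist (y - x)) (fun _ => cycleDist (u - x))) ?_
    · simpa [cycleDist_zero] using this
    · rintro (a | a) (b | b) hab
      · exact cycleDist_sub_le_of_adj hab x
      · simp [hab.1]
      · simp [hab.1]
      · simp
  have hpendant : ∀ x z, cycleDist (x - u) + 1 ≤ K.dist (.inr z) (.inl x) := by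
    intro x z
    have := (hconn (.inr z) (.inl x)).le_add_dist
      (f := Sum.elim (fun y => cycleDist (y - u) + 1) (fun _ => 0)) ?_
    · simpa using this
    · rintro (a | a) (b | b) hab
      · exact Nat.succ_le_succ (cycleDist_sub_le_of_adj hab u)
      · simp
      · simp [hab.1, cycleDist_zero]
      · simp
  have hcard : Fintype.card {y : Fin 2 // y ≠ w} = 1 := by simp
  rw [two_mul_wienerIndex]
  calc (n + 4) * ((n + 2) ^ 2 / 4) + 2 * (n + 2)
      = ∑ x : Fin (n + 2), (∑ y : Fin (n + 2), cycleDist (y - x) +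
          ∑ _z : {y : Fin 2 // y ≠ w}, (cycleDist (x - u) + 1)) +
        -- The final `0` is the pendant vertex's distance to itself.
        ∑ _z : {y : Fin 2 // y ≠ w}, (∑ x : Fin (n + 2), (cycleDist (x - u) + 1) + 0) := by
        simp only [Finset.sum_add_distrib, sum_cycleDist_sub, Finset.sum_const, Finset.card_univ,
          hcard, Fintype.card_fin, smul_eq_mul, one_mul]
        ring
    _ ≤ _ := by
        simp only [Fintype.sum_sum_type]
        gcongr with x _ y _ z _ z _ x _
        · exact hcycle x y
        · rw [dist_comm]
          exact hpendant x z
        · exact hpendant x z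
        · exact Nat.zero_le _

end SimpleGraph

theorem mainTheorem2 (n : ℕ) (hn : 4 ≤ n) (u : Fin (n - 1)) (w : Fin 2) :
    (Fintype.card (Fin (n - 1) ⊕ {y : Fin 2 // y ≠ w}) = n ∧
      ((SimpleGraph.cycleGraph (n - 1)).coalescence u (SimpleGraph.cycleGraph 2) w).Connected ∧
      ((SimpleGraph.cycleGraph (n - 1)).coalescence u
        (SimpleGraph.cycleGraph 2) w).blocks.ncard = 2) ∧
    ∀ (V : Type*) [Fintype V] (G : SimpleGraph V),
      Fintype.card V = n → G.Connected → G.blocks.ncard = 2 →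
        G.wienerIndex ≤
          ((SimpleGraph.cycleGraph (n - 1)).coalescence u
            (SimpleGraph.cycleGraph 2) w).wienerIndex := by
  obtain ⟨k, rfl⟩ : ∃ k, n = k + 3 := ⟨n - 3, by omega⟩
  change Fin (k + 2) at u
  refine ⟨⟨?_, ?_, ?_⟩, fun V _ G hV hG hb => ?_⟩
  · simp
  · exact SimpleGraph.cycleGraph_connected.coalescence u w SimpleGraph.cycleGraph_connected
  · exact (SimpleGraph.cycleGraph_isNonseparable k).ncard_blocks_coalescence
      -- Index `0` gives `cycleGraph 2`, which is the single edge.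
      (SimpleGraph.cycleGraph_isNonseparable 0) u w
  · have h1 := hG.two_mul_wienerIndex_le_of_ncard_blocks hb (m := k + 2) hV (by omega)
    have h2 := SimpleGraph.le_two_mul_wienerIndex_coalescence k u w
    have := h1.trans h2
    exact Nat.le_of_mul_le_mul_left this (by norm_num)
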